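/- **Setting.** A mean-payoff game $\Gamma=(G,V_{\mathrm{Max}},V_{\mathrm{Min}})$ is a finite directed graph $G=(V,E,w)$ with integer edge weights, in which every vertex has an outgoing edge, together with a partition $V=V_{\mathrm{Max}}\sqcup V_{\mathrm{Min}}$. The owner of the current vertex chooses the next edge; a (general) strategy may depend on the whole history, a positional one only on the current vertex. Let $b\in\mathbb N_0$. For $v\in V$, $\mathsf{lwub}_b^\Gamma(v)\in\mathbb N_0\cup\{\infty\}$ is the least $x\in\mathbb N_0$ for which Max has a strategy such that, against every strategy of Min, the resulting play $v=v_0,v_1,\dots$ satisfies $x+\sum_{i<n}w(v_i,v_{i+1})\ge 0$ for all $n$ and $\sum_{i=n_1}^{n_2-1}w(v_i,v_{i+1})\ge -b$ for all $n_1<n_2$ (and $\infty$ if there is no such $x$); $\mathsf{lb}^\Gamma(v)$ is defined in the same way without the second condition. A strategy of Max is optimal (for $b$) if from every $v$ with $\mathsf{lwub}_b^\Gamma(v)<\infty$ the initial energy $\mathsf{lwub}_b^\Gamma(v)$ suffices when Max uses it; a strategy of Min is optimal if against it Max needs at least $\mathsf{lwub}_b^\Gamma(v)$ units of initial energy from every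 $v$ with a finite value, and loses with any amount of initial energy from every $v$ with value $\infty$. **The algorithm** $\textsc{LowerWeakUpperBound}(\Gamma,b)$. For a positional strategy $\pi$ of Min let $E_\pi$ be the set of edges that leave a vertex of Max or follow $\pi$, and $G_\pi=(V,E_\pi,w)$. Choose any positional strategy $\pi_0$ of Min and put $d_{-1}=\mathbf 0$. For $i=0,1,\dots$: 1. *Evaluate* $\pi_i$: start with $d:=d_{i-1}\in(\mathbb Z\cup\{-\infty\})^V$ and $B:=\{v: d(v)=0,\ \max_{(v,u)\in E_{\pi_i}}(w(v,u)-d(v)+d(u))\ge 0\}$. Replace $d$ by the vector that gives each $v$ with $d(v)>-\infty$ the weight of a longest path in $G_{\pi_i}$ from $v$ to $B$ (only the last vertex in $B$) that stays in $\{u: d(u)>-\infty\}$ and all of whose suffixes have weight at least $-b$, and gives $-\infty$ to every other vertex and to every vertex without such a path. Then remove from $B$ all vertices $v$ with $\max_{(v,u)\in E_{\pi_i}}(w(v,u)-d(v)+d(u))<0$. Repeat both operations until $B$ does not change; let $d_i$ be the resulting $d$. 2. *Improve*: if some edge $(v,u)\in E$ with $v\in V_{\mathrm{Min}}$, $d_i(v)>-\infty$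 satisfies $d_i(v)>d_i(u)+w(v,u)$, let $\pi_{i+1}$ follow some such edge at every $v$ that has one, and agree with $\pi_i$ elsewhere, and continue; otherwise stop and return $-d_i$. **Theorem.** For every $(\Gamma,b)$, every initial strategy $\pi_0$ and all choices of the improving edges, the algorithm terminates (and each $\pi_0$ has a terminating execution). For every terminating execution, with last index $N$, the following hold. * $-d_N(v)=\mathsf{lwub}_b^\Gamma(v)$ for every $v\in V$. * If $b=(|V|-1)\cdot W$ with $W=\max_{e\in E}|w(e)|$, then $-d_N(v)=\mathsf{lb}^\Gamma(v)$ for every $v\in V$. * Let $B$ be the final set of the last evaluation. There is a positional strategy $\sigma$ of Max which, at every $v\in V_{\mathrm{Max}}$ with $d_N(v)>-\infty$, follows an edge $(v,u)$ with $w(v,u)-d_N(v)+d_N(u)\ge 0$ if $v\in B$, and otherwise the first edge of a longest path of weight $d_N(v)$ from $v$ to $B$ (in $G_{\pi_N}$, through vertices with $d_N>-\infty$, all suffixes of weight at least $-b$). Every such $\sigma$ is optimal for Max. * The following strategy of Min is optimal: at $v\in V_{\mathrm{Min}}$ she plays $\pi_k(v)$, where $k\le N$ is the least index such that $d_k(x)=-\infty$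 for some vertex $x$ visited so far (including $v$), and $k=N$ if there is none. In particular she never switches to a strategy with a higher index. -/

import Mathlib

open scoped BigOperators

/-- A mean-payoff game with vertex set `V`: a directed graph with integer edge weights in which
every vertex has an outgoing edge, and the set `VMax` of the vertices of Max; all other vertices
belong to Min.  Only the values of `weight` on edges matter. -/
structure MPG (V : Type*) where
  Edge : V → V → Prop
  weight : V → V → ℤ
  VMax : Set V
  exists_edge : ∀ v, ∃ u, Edge v u

namespace MPG

variable {V : Type*}

/-- The set of the vertices of Min. -/
def VMin (G : MPG V) : Set V := G.VMaxᶜ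

/-! ### Strategies and plays -/

/-- A (general) strategy of Max.  `move h v` is the choice after the finite path `h ++ [v]`,
whose last vertex is `v`; the values outside finite paths that end in `VMax` are never used. -/
structure MaxStrategy (G : MPG V) where
  move : List V → V → V
  legal : ∀ (h : List V) (v : V), v ∈ G.VMax → List.IsChain G.Edge (h ++ [v]) →
    G.Edge v (move h v)

/-- A (general) strategy of Min. -/
structure MinStrategy (G : MPG V) where
  move : List V → V → V
  legal : ∀ (h : List V) (v : V), v ∈ G.VMin → List.IsChain G.Edge (h ++ [v]) →
    G.Edge v (move h v)

/-- A positional strategy of Max (the values of `next` outside `VMax` are never used). -/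
structure MaxPositional (G : MPG V) where
  next : V → V
  legal : ∀ v ∈ G.VMax, G.Edge v (next v)

/-- A positional strategy of Min (the values of `next` outside `VMin` are never used). -/
structure MinPositional (G : MPG V) where
  next : V → V
  legal : ∀ v ∈ G.VMin, G.Edge v (next v)

/-- A positional strategy of Max as a general strategy. -/
def MaxPositional.toStrategy {G : MPG V} (σ : G.MaxPositional) : G.MaxStrategy where
  move _ v := σ.next v
  legal _ v hv _ := σ.legal v hv

open Classical in
/-- The state of a play after `n` moves: the list of the vertices visited before the current one,
and the current vertex. -/
noncomputable def playState (G : MPG V) (v : V) (σ : G.MaxStrategy) (π : G.MinStrategy) :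
    ℕ → List V × V
  | 0 => ([], v)
  | n + 1 =>
    let s := playState G v σ π n
    (s.1 ++ [s.2], if s.2 ∈ G.VMax then σ.move s.1 s.2 else π.move s.1 s.2)

/-- The outcome `v = v₀, v₁, v₂, …` of two strategies from the initial vertex `v`. -/
noncomputable def outcome (G : MPG V) (v : V) (σ : G.MaxStrategy) (π : G.MinStrategy) (n : ℕ) :
    V :=
  (G.playState v σ π n).2

/-- The weight of the segment of an infinite path `p` between the positions `m` and `n`. -/
def segmentWeight (G : MPG V) (p : ℕ → V) (m n : ℕ) : ℤ :=
  ∑ i ∈ Finset.Ico m n, G.weight (p i) (p (i + 1))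

/-! ### The lower-bound and the lower-weak-upper-bound problem -/

/-- With initial energy `x`, the energy level never goes below zero along `p`. -/
def KeepsNonneg (G : MPG V) (x : ℕ) (p : ℕ → V) : Prop :=
  ∀ n : ℕ, 0 ≤ (x : ℤ) + G.segmentWeight p 0 n

/-- No segment of `p` has weight less than `-b`. -/
def SegmentsBounded (G : MPG V) (b : ℕ) (p : ℕ → V) : Prop :=
  ∀ m n : ℕ, m < n → -(b : ℤ) ≤ G.segmentWeight p m n

/-- The winning condition of Max in the lower-weak-upper-bound problem with initial energy `x`. -/
def Survives (G : MPG V) (b x : ℕ) (p : ℕ → V) : Prop :=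
  G.KeepsNonneg x p ∧ G.SegmentsBounded b p

/-- The minimum of a set of natural numbers, where the minimum of the empty set is `∞`. -/
noncomputable def minOrTop (S : Set ℕ) : ℕ∞ := ⨅ x ∈ S, (x : ℕ∞)

/-- The minimal sufficient initial energy in the lower-bound problem. -/
noncomputable def lb (G : MPG V) (v : V) : ℕ∞ :=
  minOrTop {x : ℕ | ∃ σ : G.MaxStrategy, ∀ π : G.MinStrategy, G.KeepsNonneg x (G.outcome v σ π)}

/-- The minimal sufficient initial energy in the lower-weak-upper-bound problem. -/
noncomputable def lwub (G : MPG V) (b : ℕ) (v : V) : ℕ∞ :=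
  minOrTop {x : ℕ | ∃ σ : G.MaxStrategy, ∀ π : G.MinStrategy, G.Survives b x (G.outcome v σ π)}

/-- `σ` is an optimal strategy of Max for the lower-weak-upper-bound problem: from every vertex
with a finite value `x`, the initial energy `x` is sufficient. -/
def IsOptimalMax (G : MPG V) (b : ℕ) (σ : G.MaxStrategy) : Prop :=
  ∀ (v : V) (x : ℕ), G.lwub b v = x → ∀ π : G.MinStrategy, G.Survives b x (G.outcome v σ π)

/-- `π` is an optimal strategy of Min for the lower-weak-upper-bound problem: from every vertex
with a finite value `y`, Max needs at least `y` units of initial energy, and from every vertex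
with value `∞`, Max loses with any amount of initial energy. -/
def IsOptimalMin (G : MPG V) (b : ℕ) (π : G.MinStrategy) : Prop :=
  ∀ v : V,
    (∀ y : ℕ, G.lwub b v = y →
      ∀ (σ : G.MaxStrategy) (x : ℕ), G.Survives b x (G.outcome v σ π) → y ≤ x) ∧
    (G.lwub b v = ⊤ → ∀ (σ : G.MaxStrategy) (x : ℕ), ¬ G.Survives b x (G.outcome v σ π))

open Classical in
/-- The maximal absolute edge weight `W`. -/
noncomputable def maxAbsWeight [Fintype V] (G : MPG V) : ℕ :=
  (Finset.univ.filter fun e : V × V => G.Edge e.1 e.2).sup fun e => (G.weight e.1 e.2).natAbs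

/-! ### Restriction to a positional strategy of Min, and paths -/

/-- The restricted game `Γ_π`: the edges from vertices of Min that do not follow `π` are
deleted. -/
def restrict (G : MPG V) (π : G.MinPositional) : MPG V where
  Edge u v := G.Edge u v ∧ (u ∈ G.VMax ∨ π.next u = v)
  weight := G.weight
  VMax := G.VMax
  exists_edge v := by
    by_cases hv : v ∈ G.VMax
    · obtain ⟨u, hu⟩ := G.exists_edge v
      exact ⟨u, hu, Or.inl hv⟩
    · exact ⟨π.next v, π.legal v hv, Or.inr rfl⟩

/-- The weight of a finite path. -/
def pathWeight (G : MPG V) : List V → ℤ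
  | [] => 0
  | [_] => 0
  | u :: v :: p => G.weight u v + pathWeight G (v :: p)

/-- `p` is a path to `B` inside `D`: the last vertex of `p`, and only the last one, is in `B`,
and all vertices of `p` are in `D`. -/
def IsPathTo (G : MPG V) (D B : Set V) (p : List V) : Prop :=
  List.IsChain G.Edge p ∧ (∀ x ∈ p, x ∈ D) ∧ ∃ q t, p = q ++ [t] ∧ t ∈ B ∧ ∀ x ∈ q, x ∉ B

/-- A path to `B` inside `D` such that the weight of each of its suffixes is at least `-b`. -/
def IsAdmissiblePath (G : MPG V) (b : ℕ) (D B : Set V) (p : List V) : Prop :=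
  G.IsPathTo D B p ∧ ∀ q, q <:+ p → -(b : ℤ) ≤ G.pathWeight q

/-! ### Strategy evaluation -/

open Classical in
/-- The longest-path subroutine `Dijkstra(G, b, B, d)`.  It works in the subgraph induced by
`D = {v | d v > -∞}`.  A vertex gets the weight of a longest path to `B` among those whose
suffixes all weigh at least `-b`, and `-∞` if there is no such path; in particular the vertices
outside `D` get `-∞`. -/
noncomputable def dijkstra (G : MPG V) (b : ℕ) (B : Finset V) (d : V → WithBot ℤ) (v : V) :
    WithBot ℤ :=
  if h : ∃ m : ℤ, IsGreatest
      {z : ℤ | ∃ p : List V,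
        G.IsAdmissiblePath b {x | d x ≠ ⊥} (B : Set V) (v :: p) ∧ z = G.pathWeight (v :: p)} m
  then ((h.choose : ℤ) : WithBot ℤ)
  else ⊥

/-- The vertex `v` has an edge that is non-negative after the potential transformation by `d`:
`w(v, u) - d(v) + d(u) ≥ 0`.  It is applied to vertices with `d v = 0` only. -/
def HasNonnegEdge (G : MPG V) (d : V → WithBot ℤ) (v : V) : Prop :=
  ∃ u, G.Edge v u ∧ d v ≤ (G.weight v u : WithBot ℤ) + d u

open Classical in
/-- The loop of the strategy evaluation, for the graph of `G`, entered with the candidate set `B`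
and the vector `d`.  It returns the final candidate set and the final vector. -/
noncomputable def evalLoop (G : MPG V) (b : ℕ) (B : Finset V) (d : V → WithBot ℤ) :
    Finset V × (V → WithBot ℤ) :=
  let d' := G.dijkstra b B d
  let B' := B.filter fun v => G.HasNonnegEdge d' v
  if B' = B then (B, d') else evalLoop G b B' d'
termination_by B.card
decreasing_by
  rename_i hne
  exact Finset.card_lt_card
    (Finset.ssubset_iff_subset_ne.2 ⟨Finset.filter_subset _ _, hne⟩)

open Classical in
/-- `EvaluateStrategy(Γ, b, π, d)`.  The second component is the vector that the procedure
returns, the first one is the final set `B`. -/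
noncomputable def evaluateStrategy [Fintype V] (G : MPG V) (b : ℕ) (π : G.MinPositional)
    (d : V → WithBot ℤ) : Finset V × (V → WithBot ℤ) :=
  (G.restrict π).evalLoop b
    (Finset.univ.filter fun v => d v = 0 ∧ (G.restrict π).HasNonnegEdge d v) d

/-! ### Strategy improvement and the main loop -/

/-- The strategy improvement condition for the edge `(v, u)`. -/
def ImprovingEdge (G : MPG V) (d : V → WithBot ℤ) (v u : V) : Prop :=
  v ∈ G.VMin ∧ ⊥ < d v ∧ G.Edge v u ∧ d u + (G.weight v u : WithBot ℤ) < d v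

/-- Some edge satisfies the strategy improvement condition. -/
def Improvable (G : MPG V) (d : V → WithBot ℤ) : Prop :=
  ∃ v u, G.ImprovingEdge d v u

/-- `π'` is a possible result of improving `π`: at each vertex with an improving edge it follows
some such edge, and elsewhere it agrees with `π`. -/
def IsImprovement (G : MPG V) (d : V → WithBot ℤ) (π π' : G.MinPositional) : Prop :=
  ∀ v, ((∃ u, G.ImprovingEdge d v u) → G.ImprovingEdge d v (π'.next v)) ∧
    ((¬ ∃ u, G.ImprovingEdge d v u) → π'.next v = π.next v)

/-- The vector with which the `i`-th strategy evaluation is called: `d_{i-1}`, where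
`d_{-1} = 0`. -/
def previous (d : ℕ → V → WithBot ℤ) : ℕ → V → WithBot ℤ
  | 0 => fun _ => 0
  | i + 1 => d i

/-- The strategies `π 0, …, π N` and the vectors `d 0, …, d N` arise in the first `N + 1`
iterations of `LowerWeakUpperBound(Γ, b)`, for some choice of the initial strategy and of the
improving edges. -/
structure IsRun [Fintype V] (G : MPG V) (b : ℕ) (π : ℕ → G.MinPositional)
    (d : ℕ → V → WithBot ℤ) (N : ℕ) : Prop where
  eval : ∀ i ≤ N, d i = (G.evaluateStrategy b (π i) (previous d i)).2
  improvable : ∀ i < N, G.Improvable (d i)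
  improve : ∀ i < N, G.IsImprovement (d i) (π i) (π (i + 1))

/-- The run stops after the evaluation of `π N`, and the vector `-(d N)` is returned. -/
def IsCompleteRun [Fintype V] (G : MPG V) (b : ℕ) (π : ℕ → G.MinPositional)
    (d : ℕ → V → WithBot ℤ) (N : ℕ) : Prop :=
  G.IsRun b π d N ∧ ¬ G.Improvable (d N)

/-- Negation from `ℤ ∪ {-∞}` to `ℤ ∪ {∞}`. -/
def negate : WithBot ℤ → WithTop ℤ
  | ⊥ => ⊤
  | (z : ℤ) => ((-z : ℤ) : WithTop ℤ)

/-- The inclusion of `ℕ ∪ {∞}` in `ℤ ∪ {∞}`. -/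
noncomputable def ofENat (x : ℕ∞) : WithTop ℤ :=
  ENat.recTopCoe (C := fun _ => WithTop ℤ) ⊤ (fun n => ((n : ℤ) : WithTop ℤ)) x

/-! ### The strategies obtained from a complete run -/

/-- The positional strategy `σ` of Max is read off the data of the last evaluation (with the last
strategy `π`, the final set `B` and the final vector `d`).  At a vertex of Max in `B`, it follows
an edge that is non-negative after the potential transformation.  At any other vertex of Max with
finite `d`, it follows the first edge of a longest admissible path to `B`, that is, of an
admissible path of weight `d v`. -/
def ReadOffForest (G : MPG V) (b : ℕ) (π : G.MinPositional) (B : Finset V) (d : V → WithBot ℤ)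
    (σ : G.MaxPositional) : Prop :=
  ∀ v ∈ G.VMax, d v ≠ ⊥ →
    (v ∈ B → d v ≤ (G.weight v (σ.next v) : WithBot ℤ) + d (σ.next v)) ∧
    (v ∉ B → ∃ p : List V,
      (G.restrict π).IsAdmissiblePath b {x | d x ≠ ⊥} (B : Set V) (v :: σ.next v :: p) ∧
      d v = ((G.restrict π).pathWeight (v :: σ.next v :: p) : WithBot ℤ))

/-- The index of the strategy that Min uses after the vertices in `h` have been visited: the
least `i ≤ N` such that `d i x = -∞` for some visited vertex `x`, and `N` if there is none. -/
noncomputable def switchIndex (d : ℕ → V → WithBot ℤ) (N : ℕ) (h : List V) : ℕ :=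
  sInf {i : ℕ | i = N ∨ ∃ x ∈ h, d i x = ⊥}

/-- Min's strategy with memory that switches through the positional strategies `π 0, …, π N`,
never to a higher index. -/
noncomputable def switchingStrategy (G : MPG V) (π : ℕ → G.MinPositional)
    (d : ℕ → V → WithBot ℤ) (N : ℕ) : G.MinStrategy where
  move h v := (π (switchIndex d N (h ++ [v]))).next v
  legal h v hv _ := (π (switchIndex d N (h ++ [v]))).legal v hv

end MPG

namespace MPG

variable {V : Type*}

/-! ### Finite paths -/

/-! Everything rests on an invariant of the pair (B, d) in the graph restricted to Min's current
strategy, `EvalInv`: d is non-positive and zero on B; w(v,u) + d(u) ≤ d(v) on every edge leaving a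
finite vertex outside B; and every closed walk through finite vertices outside B has negative
weight. It survives longest-path passes, deletions from B and improvements: at a finite vertex
outside the new B, each edge is either strict, w(v,u) + d(u) < d(v), or an old edge at a vertex
already outside the old B. By telescoping, a closed walk with a strict edge is negative; one without
is an old closed walk (`NegCycles.of_potential`).

Upper bound on the value: after the last evaluation, d(v) ≤ w(v,u) + d(u) holds for all edges of Min
and for the chosen edges of Max, so along a play d telescopes, and -b ≤ d ≤ 0 bounds all segments
(`survives_of_potential`).

Lower bound: a play that avoids B while d stays finite loses unboundedly much energy, so a surviving
play reaches B, and its segment up to there competes in the longest-path computation. Hence d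
remains finite along a surviving play that follows the evaluated strategy, and some initial segment
weighs at most d. Against the switching strategy this excludes every final index below N and yields
the bound for d_N (`IsRun.exists_segmentWeight_le`).

Termination: d_i strictly decreases within a finite set of vectors (`not_exists_infinite_run`). -/

theorem pathWeight_cons_cons (G : MPG V) (v u : V) (p : List V) :
    G.pathWeight (v :: u :: p) = G.weight v u + G.pathWeight (u :: p) := rfl

theorem pathWeight_append_cons (G : MPG V) (a : List V) (v : V) (e : List V) :
    G.pathWeight (a ++ v :: e) = G.pathWeight (a ++ [v]) + G.pathWeight (v :: e) := by
  induction a with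
  | nil => simp [pathWeight]
  | cons x a ih =>
    cases a with
    | nil => simp [pathWeight]
    | cons y a =>
      simp only [List.cons_append, pathWeight_cons_cons] at ih ⊢
      rw [ih, add_assoc]

theorem neg_length_mul_le_pathWeight (G : MPG V) {W : ℤ}
    (hW : ∀ v u, G.Edge v u → -W ≤ G.weight v u) :
    ∀ (p : List V) (v : V), List.IsChain G.Edge (v :: p) →
      -(p.length * W) ≤ G.pathWeight (v :: p)
  | [], v, _ => by simp [pathWeight]
  | u :: p, v, h => by
    rw [List.isChain_cons_cons] at h
    have h1 := hW v u h.1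
    have h2 := neg_length_mul_le_pathWeight G hW p u h.2
    rw [pathWeight_cons_cons]
    push_cast [List.length_cons]
    linarith

theorem isPathTo_singleton {G : MPG V} {D B : Set V} {v : V} :
    G.IsPathTo D B [v] ↔ v ∈ D ∧ v ∈ B := by
  constructor
  · rintro ⟨-, hD, q, t, hq, ht, -⟩
    cases q with
    | nil => simp at hq; subst hq; exact ⟨hD _ (by simp), ht⟩
    | cons x q => simp at hq
  · rintro ⟨h1, h2⟩
    exact ⟨by simp, by simpa using h1, [], v, rfl, h2, by simp⟩

theorem isPathTo_cons_cons {G : MPG V} {D B : Set V} {v u : V} {p : List V} :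
    G.IsPathTo D B (v :: u :: p) ↔
      G.Edge v u ∧ v ∈ D ∧ v ∉ B ∧ G.IsPathTo D B (u :: p) := by
  constructor
  · rintro ⟨hc, hD, q, t, hq, ht, hqB⟩
    rw [List.isChain_cons_cons] at hc
    cases q with
    | nil => simp at hq
    | cons x q =>
      simp only [List.cons_append, List.cons.injEq] at hq
      obtain ⟨rfl, hq⟩ := hq
      exact ⟨hc.1, hD _ (by simp), hqB _ (by simp), hc.2,
        fun x hx => hD x (List.mem_cons_of_mem _ hx), q, t, hq, ht,
        fun x hx => hqB x (List.mem_cons_of_mem _ hx)⟩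
  · rintro ⟨he, hv, hvB, hc, hD, q, t, hq, ht, hqB⟩
    refine ⟨List.isChain_cons_cons.2 ⟨he, hc⟩, ?_, v :: q, t, by rw [hq]; rfl, ht, ?_⟩
    · intro x hx
      rcases List.mem_cons.1 hx with rfl | hx
      exacts [hv, hD x hx]
    · intro x hx
      rcases List.mem_cons.1 hx with rfl | hx
      exacts [hvB, hqB x hx]

theorem IsPathTo.of_append {G : MPG V} {D B : Set V} {v : V} {e : List V} :
    ∀ {a : List V}, G.IsPathTo D B (a ++ v :: e) →
      (∀ x ∈ a, x ∈ D ∧ x ∉ B) ∧ G.IsPathTo D B (v :: e)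
  | [], h => ⟨by simp, h⟩
  | [x], h => by
    obtain ⟨-, h1, h2, h3⟩ := isPathTo_cons_cons.1 h
    exact ⟨by simp [h1, h2], h3⟩
  | x :: y :: a, h => by
    obtain ⟨-, h1, h2, h3⟩ := isPathTo_cons_cons.1 h
    obtain ⟨h4, h5⟩ := IsPathTo.of_append (a := y :: a) h3
    refine ⟨fun z hz => ?_, h5⟩
    rcases List.mem_cons.1 hz with rfl | hz
    exacts [⟨h1, h2⟩, h4 z hz]

theorem isAdmissiblePath_singleton {G : MPG V} {b : ℕ} {D B : Set V} {v : V} :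
    G.IsAdmissiblePath b D B [v] ↔ v ∈ D ∧ v ∈ B := by
  rw [IsAdmissiblePath, isPathTo_singleton, and_iff_left]
  intro q hq
  rcases List.suffix_cons_iff.1 hq with rfl | hq
  · simp [pathWeight]
  · simp [List.suffix_nil.1 hq, pathWeight]

theorem isAdmissiblePath_cons_cons {G : MPG V} {b : ℕ} {D B : Set V} {v u : V} {p : List V} :
    G.IsAdmissiblePath b D B (v :: u :: p) ↔
      G.Edge v u ∧ v ∈ D ∧ v ∉ B ∧ -(b : ℤ) ≤ G.pathWeight (v :: u :: p) ∧
        G.IsAdmissiblePath b D B (u :: p) := by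
  rw [IsAdmissiblePath, IsAdmissiblePath, isPathTo_cons_cons]
  constructor
  · rintro ⟨⟨h1, h2, h3, h4⟩, h5⟩
    exact ⟨h1, h2, h3, h5 _ (List.suffix_refl _), h4,
      fun q hq => h5 q (hq.trans (List.suffix_cons _ _))⟩
  · rintro ⟨h1, h2, h3, h4, h5, h6⟩
    refine ⟨⟨h1, h2, h3, h5⟩, fun q hq => ?_⟩
    rcases List.suffix_cons_iff.1 hq with rfl | hq
    exacts [h4, h6 q hq]

/-! ### Walks -/

/-- `G.Walk S v t n z`: there is a walk from `v` to `t` with `n` edges and weight `z` all of whose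
vertices, except possibly the last one, are in `S`. -/
inductive Walk (G : MPG V) (S : Set V) : V → V → ℕ → ℤ → Prop
  | nil (v : V) : Walk G S v v 0 0
  | cons {v u t : V} {n : ℕ} {z : ℤ} (hv : v ∈ S) (he : G.Edge v u) (h : Walk G S u t n z) :
      Walk G S v t (n + 1) (G.weight v u + z)

/-- Every closed walk inside `S` has negative weight. -/
def NegCycles (G : MPG V) (S : Set V) : Prop :=
  ∀ v n z, G.Walk S v v (n + 1) z → z < 0

theorem Walk.of_isChain {G : MPG V} {S : Set V} {t : V} :
    ∀ {p : List V} {v : V}, List.IsChain G.Edge (v :: p ++ [t]) → (∀ x ∈ v :: p, x ∈ S) →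
      G.Walk S v t (p.length + 1) (G.pathWeight (v :: p ++ [t]))
  | [], v, hc, hS => by
    have := Walk.cons (hS v (by simp)) (List.isChain_cons_cons.1 hc).1 (Walk.nil t)
    simpa [pathWeight] using this
  | u :: p, v, hc, hS => by
    have hc' := List.isChain_cons_cons.1 hc
    exact Walk.cons (hS v (by simp)) hc'.1
      (Walk.of_isChain hc'.2 fun x hx => hS x (List.mem_cons_of_mem _ hx))

theorem segmentWeight_eq_add (G : MPG V) (p : ℕ → V) {m n : ℕ} (h : m < n) :
    G.segmentWeight p m n = G.weight (p m) (p (m + 1)) + G.segmentWeight p (m + 1) n :=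
  Finset.sum_eq_sum_Ico_succ_bot h _

theorem segmentWeight_add (G : MPG V) (p : ℕ → V) {k m n : ℕ} (h : k ≤ m) (h' : m ≤ n) :
    G.segmentWeight p k m + G.segmentWeight p m n = G.segmentWeight p k n :=
  Finset.sum_Ico_consecutive _ h h'

theorem segmentWeight_shift (G : MPG V) (p : ℕ → V) (k m n : ℕ) :
    G.segmentWeight (fun i => p (k + i)) m n = G.segmentWeight p (k + m) (k + n) := by
  rw [add_comm k m, add_comm k n]
  exact Finset.sum_Ico_add (fun i => G.weight (p i) (p (i + 1))) m n k

theorem Walk.of_seq {G : MPG V} {S : Set V} {p : ℕ → V} (hS : ∀ i, p i ∈ S)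
    (he : ∀ i, G.Edge (p i) (p (i + 1))) (m n : ℕ) :
    G.Walk S (p m) (p (m + n)) n (G.segmentWeight p m (m + n)) := by
  induction n generalizing m with
  | zero => simpa [segmentWeight] using Walk.nil (p m)
  | succ n ih =>
    rw [segmentWeight_eq_add G p (by omega)]
    have := ih (m + 1)
    rw [show m + 1 + n = m + (n + 1) by omega] at this
    exact Walk.cons (hS m) (he m) this

/-- An infinite path whose closed subwalks are all negative has unbounded weight. -/
theorem NegCycles.exists_segmentWeight_lt [Finite V] {G : MPG V} {S : Set V}
    (hG : G.NegCycles S) {p : ℕ → V} (hS : ∀ i, p i ∈ S)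
    (he : ∀ i, G.Edge (p i) (p (i + 1))) (M : ℕ) : ∃ n, G.segmentWeight p 0 n < -(M : ℤ) := by
  obtain ⟨v, hv⟩ := Finite.exists_infinite_fiber p
  rw [Set.infinite_coe_iff] at hv
  obtain ⟨t, ht⟩ := hv.nonempty
  -- By pigeonhole `v` is visited infinitely often; each return to `v` costs at least one unit.
  have key : ∀ k : ℕ, ∃ n, t ≤ n ∧ p n = v ∧ G.segmentWeight p t n ≤ -(k : ℤ) := by
    intro k
    induction k with
    | zero => exact ⟨t, le_rfl, ht, by simp [segmentWeight]⟩
    | succ k ih =>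
      obtain ⟨n, htn, hn, hk⟩ := ih
      obtain ⟨m, hm, hnm⟩ := hv.exists_gt n
      obtain ⟨c, rfl⟩ := Nat.exists_eq_add_of_lt hnm
      have hw := Walk.of_seq hS he n (c + 1)
      have hm' : p (n + (c + 1)) = v := hm
      rw [hm', hn] at hw
      have := hG _ _ _ hw
      refine ⟨n + (c + 1), by omega, hm', ?_⟩
      rw [← segmentWeight_add G p htn (by omega : n ≤ n + (c + 1))]
      push_cast
      omega
  -- The last summand compensates a possible gain before the first chosen visit `t`.
  obtain ⟨n, htn, -, hn⟩ := key (M + 1 + (G.segmentWeight p 0 t).toNat)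
  refine ⟨n, ?_⟩
  rw [← segmentWeight_add G p (Nat.zero_le t) htn]
  push_cast at hn
  have := Int.self_le_toNat (G.segmentWeight p 0 t)
  omega

/-- If `d` is a potential whose tight edges of `G` at `S` are edges of `H` at `S'`, then negative
cycles are inherited from `H` and `S'` by `G` and `S`. -/
theorem NegCycles.of_potential {G H : MPG V} {S S' : Set V} (hH : H.NegCycles S')
    {d : V → WithBot ℤ} (hw : H.weight = G.weight) (hd : ∀ v ∈ S, d v ≠ ⊥)
    (hS : ∀ v ∈ S, ∀ u, G.Edge v u → (G.weight v u : WithBot ℤ) + d u < d v ∨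
      ((G.weight v u : WithBot ℤ) + d u ≤ d v ∧ v ∈ S' ∧ H.Edge v u)) :
    G.NegCycles S := by
  -- Telescoping is strict as soon as one edge is strict; otherwise the whole walk lies in `H` and
  -- `S'`. For t = v both alternatives make the weight negative.
  have key : ∀ {v t : V} {n : ℕ} {z : ℤ}, G.Walk S v t n z → d t ≠ ⊥ →
      (z : WithBot ℤ) + d t < d v ∨ ((z : WithBot ℤ) + d t ≤ d v ∧ H.Walk S' v t n z) := by
    intro v t n z h ht
    induction h with
    | nil v => exact Or.inr ⟨by simp, Walk.nil v⟩
    | @cons v u t n z hv he h ih =>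
      have hdv := hd v hv
      have hs := hS v hv u he
      have ih := ih ht
      -- `u` may be the last vertex and thus outside `S`; its value is finite because the induction
      -- hypothesis bounds it below by a finite one.
      have hdu : d u ≠ ⊥ := by
        intro h0
        rw [h0] at ih
        obtain ⟨c, hc⟩ := WithBot.ne_bot_iff_exists.1 ht
        rw [← hc] at ih
        rcases ih with ih | ⟨ih, -⟩
        · exact absurd ih (by simp)
        · rw [← WithBot.coe_add] at ih; simp at ih
      obtain ⟨x, hx⟩ := WithBot.ne_bot_iff_exists.1 hdv
      obtain ⟨y, hy⟩ := WithBot.ne_bot_iff_exists.1 hdu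
      obtain ⟨c, hc⟩ := WithBot.ne_bot_iff_exists.1 ht
      rw [← hx, ← hy] at hs
      rw [← hc, ← hy] at ih
      rw [← hx, ← hc]
      simp only [← WithBot.coe_add, WithBot.coe_lt_coe, WithBot.coe_le_coe] at hs ih ⊢
      rcases hs with hs | ⟨hs, hs1, hs2⟩
      · left
        rcases ih with ih | ⟨ih, -⟩ <;> omega
      · rcases ih with ih | ⟨ih, ih2⟩
        · left; omega
        · right
          refine ⟨by omega, ?_⟩
          rw [← hw]
          exact Walk.cons hs1 hs2 ih2
  intro v n z h
  have hv : v ∈ S := by cases h; assumption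
  by_contra hz
  have := key h (hd v hv)
  obtain ⟨x, hx⟩ := WithBot.ne_bot_iff_exists.1 (hd v hv)
  rw [← hx] at this
  simp only [← WithBot.coe_add, WithBot.coe_lt_coe, WithBot.coe_le_coe] at this
  rcases this with h | ⟨-, h⟩
  · omega
  · exact hz (hH _ _ _ h)

/-- If all cycles in `D \ B` are negative, a path to `B` can be replaced by a simple one. -/
theorem IsPathTo.exists_nodup {G : MPG V} {D B : Set V} (hG : G.NegCycles {x | x ∈ D ∧ x ∉ B}) :
    ∀ {p : List V} {v : V}, G.IsPathTo D B (v :: p) → ∃ q, G.IsPathTo D B (v :: q) ∧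
      (v :: q).Nodup ∧ G.pathWeight (v :: p) ≤ G.pathWeight (v :: q)
  | [], v, h => ⟨[], h, by simp, le_rfl⟩
  | u :: p, v, h => by
    obtain ⟨he, hv, hvB, h'⟩ := isPathTo_cons_cons.1 h
    obtain ⟨q, hq, hnd, hle⟩ := IsPathTo.exists_nodup hG h'
    -- If `v` recurs, the cycle back to `v` precedes the final vertex, so it avoids `B` and is
    -- negative: cutting it out increases the weight.
    by_cases hmem : v ∈ u :: q
    · obtain ⟨a, e, hae⟩ := List.append_of_mem hmem
      have hvq : G.IsPathTo D B (v :: (a ++ v :: e)) := by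
        rw [← hae]; exact isPathTo_cons_cons.2 ⟨he, hv, hvB, hq⟩
      obtain ⟨h1, h2⟩ := IsPathTo.of_append (a := v :: a) hvq
      refine ⟨e, h2, ?_, ?_⟩
      · rw [hae] at hnd
        exact (List.nodup_append.1 hnd).2.1
      · have hc : List.IsChain G.Edge (v :: a ++ [v]) := by
          refine List.IsChain.prefix hvq.1 ⟨e, by simp⟩
        have hneg := hG _ _ _ (Walk.of_isChain hc h1)
        have hsplit := pathWeight_append_cons G (v :: a) v e
        have : G.pathWeight (v :: u :: q) = G.pathWeight (v :: a ++ v :: e) := by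
          rw [hae]; rfl
        rw [pathWeight_cons_cons] at this ⊢
        omega
    · refine ⟨u :: q, isPathTo_cons_cons.2 ⟨he, hv, hvB, hq⟩, List.nodup_cons.2 ⟨hmem, hnd⟩, ?_⟩
      rw [pathWeight_cons_cons, pathWeight_cons_cons]
      omega

/-- A simple path has at most |V| - 1 edges. This is the reason for the special value of `b` in the
lower-bound problem. -/
theorem IsPathTo.isAdmissiblePath_of_nodup [Fintype V] {G : MPG V} {b : ℕ} {D B : Set V}
    {W : ℕ} (hW : ∀ v u, G.Edge v u → -(W : ℤ) ≤ G.weight v u)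
    (hb : b = (Fintype.card V - 1) * W) {p : List V} (h : G.IsPathTo D B p) (hp : p.Nodup) :
    G.IsAdmissiblePath b D B p := by
  refine ⟨h, fun q hq => ?_⟩
  cases q with
  | nil => simp [pathWeight]
  | cons v q =>
    have hlen : q.length + 1 ≤ Fintype.card V :=
      (hp.sublist hq.sublist).length_le_card
    have h1 := neg_length_mul_le_pathWeight G hW q v (h.1.suffix hq)
    have h2 : q.length * W ≤ (Fintype.card V - 1) * W := Nat.mul_le_mul_right _ (by omega)
    rw [← hb] at h2
    have h3 : (q.length * W : ℤ) ≤ b := by exact_mod_cast h2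
    omega

/-- The initial segment of an infinite path up to its first visit to `B`, as a list. -/
theorem exists_isPathTo_of_seq {G : MPG V} {D B : Set V} :
    ∀ (n : ℕ) (p : ℕ → V), (∀ i, G.Edge (p i) (p (i + 1))) → (∀ i, p i ∈ D) → p n ∈ B →
      (∀ i < n, p i ∉ B) → ∃ l, G.IsPathTo D B (p 0 :: l) ∧
        G.pathWeight (p 0 :: l) = G.segmentWeight p 0 n ∧
        ∀ b : ℕ, G.SegmentsBounded b p → G.IsAdmissiblePath b D B (p 0 :: l)
  | 0, p, _, hD, hB, _ =>
    ⟨[], isPathTo_singleton.2 ⟨hD 0, hB⟩, by simp [pathWeight, segmentWeight],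
      fun _ _ => isAdmissiblePath_singleton.2 ⟨hD 0, hB⟩⟩
  | n + 1, p, he, hD, hB, hn => by
    have hsh := segmentWeight_shift G p 1
    obtain ⟨l, h1, h2, h3⟩ := exists_isPathTo_of_seq n (fun i => p (1 + i))
      (fun i => he (1 + i)) (fun i => hD (1 + i)) (by rwa [add_comm 1 n])
      (fun i hi => hn (1 + i) (by omega))
    have hw : G.pathWeight (p 0 :: p 1 :: l) = G.segmentWeight p 0 (n + 1) := by
      rw [segmentWeight_eq_add G p (Nat.succ_pos n), pathWeight_cons_cons]
      have := hsh 0 n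
      rw [add_comm 1 n] at this
      exact congrArg _ (h2.trans this)
    refine ⟨p 1 :: l, isPathTo_cons_cons.2 ⟨he 0, hD 0, hn 0 (by omega), h1⟩, hw, ?_⟩
    intro b hb
    refine isAdmissiblePath_cons_cons.2 ⟨he 0, hD 0, hn 0 (by omega), ?_, h3 b ?_⟩
    · rw [hw]; exact hb _ _ (by omega)
    · intro i j hij
      rw [hsh]
      exact hb _ _ (by omega)

/-! ### Strategy evaluation -/

/-- The invariants of the strategy evaluation. -/
structure EvalInv (G : MPG V) (B : Finset V) (d : V → WithBot ℤ) : Prop where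
  nonpos : ∀ v, d v ≤ 0
  zero : ∀ v ∈ B, d v = 0
  potential : ∀ v, d v ≠ ⊥ → v ∉ B → ∀ u, G.Edge v u → (G.weight v u : WithBot ℤ) + d u ≤ d v
  negCycles : G.NegCycles {x | d x ≠ ⊥ ∧ x ∉ B}

/-- The properties of the result of a strategy evaluation. -/
structure IsEvaluated (G : MPG V) (b : ℕ) (B : Finset V) (d : V → WithBot ℤ) : Prop
    extends EvalInv G B d where
  edge : ∀ v ∈ B, G.HasNonnegEdge d v
  attained : ∀ v, d v ≠ ⊥ → ∃ p : List V,
    G.IsAdmissiblePath b {x | d x ≠ ⊥} (B : Set V) (v :: p) ∧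
      d v = (G.pathWeight (v :: p) : WithBot ℤ)

/-- The potential inequality telescopes along the path, which ends in `B`, where `d` is zero. -/
theorem EvalInv.pathWeight_le {G : MPG V} {B : Finset V} {d : V → WithBot ℤ} (h : EvalInv G B d) :
    ∀ {p : List V} {v : V}, G.IsPathTo {x | d x ≠ ⊥} (B : Set V) (v :: p) →
      (G.pathWeight (v :: p) : WithBot ℤ) ≤ d v
  | [], v, hp => by
    rw [h.zero v (isPathTo_singleton.1 hp).2]
    simp [pathWeight]
  | u :: p, v, hp => by
    obtain ⟨he, hv, hvB, hp'⟩ := isPathTo_cons_cons.1 hp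
    have h1 := h.pathWeight_le hp'
    have h2 := h.potential v hv hvB u he
    rw [pathWeight_cons_cons, WithBot.coe_add]
    exact (add_le_add le_rfl h1).trans h2

theorem exists_of_dijkstra_ne_bot {G : MPG V} {b : ℕ} {B : Finset V} {d : V → WithBot ℤ} {v : V}
    (h : G.dijkstra b B d v ≠ ⊥) : ∃ p : List V,
      G.IsAdmissiblePath b {x | d x ≠ ⊥} (B : Set V) (v :: p) ∧
        G.dijkstra b B d v = (G.pathWeight (v :: p) : WithBot ℤ) := by
  unfold dijkstra at h ⊢
  split_ifs at h ⊢ with hm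
  · obtain ⟨p, hp, hz⟩ := hm.choose_spec.1
    exact ⟨p, hp, congrArg _ hz⟩
  · exact absurd rfl h

/-- The weights of admissible paths are integers bounded above by 0, so a greatest one exists and
the default `⊥` of `dijkstra` does not apply. -/
theorem EvalInv.pathWeight_le_dijkstra {G : MPG V} {b : ℕ} {B : Finset V} {d : V → WithBot ℤ}
    (h : EvalInv G B d) {v : V} {p : List V}
    (hp : G.IsAdmissiblePath b {x | d x ≠ ⊥} (B : Set V) (v :: p)) :
    (G.pathWeight (v :: p) : WithBot ℤ) ≤ G.dijkstra b B d v := by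
  have hm : ∃ m : ℤ, IsGreatest
      {z : ℤ | ∃ p : List V,
        G.IsAdmissiblePath b {x | d x ≠ ⊥} (B : Set V) (v :: p) ∧ z = G.pathWeight (v :: p)} m := by
    obtain ⟨m, hm, hle⟩ := Int.exists_greatest_of_bdd
      (P := fun z => ∃ p : List V,
        G.IsAdmissiblePath b {x | d x ≠ ⊥} (B : Set V) (v :: p) ∧ z = G.pathWeight (v :: p))
      ⟨0, by
        rintro z ⟨q, hq, rfl⟩
        have := (h.pathWeight_le hq.1).trans (h.nonpos v)
        exact_mod_cast this⟩ ⟨_, p, hp, rfl⟩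
    exact ⟨m, hm, fun z hz => hle z hz⟩
  rw [dijkstra, dif_pos hm]
  exact WithBot.coe_le_coe.2 (hm.choose_spec.2 ⟨p, hp, rfl⟩)

theorem EvalInv.dijkstra_le {G : MPG V} {b : ℕ} {B : Finset V} {d : V → WithBot ℤ}
    (h : EvalInv G B d) (v : V) : G.dijkstra b B d v ≤ d v := by
  by_cases hv : G.dijkstra b B d v = ⊥
  · rw [hv]; exact bot_le
  · obtain ⟨p, hp, heq⟩ := exists_of_dijkstra_ne_bot hv
    rw [heq]
    exact h.pathWeight_le hp.1

theorem EvalInv.ne_bot_of_dijkstra {G : MPG V} {b : ℕ} {B : Finset V} {d : V → WithBot ℤ}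
    (h : EvalInv G B d) {v : V} (hv : G.dijkstra b B d v ≠ ⊥) : d v ≠ ⊥ := fun h0 =>
  hv (le_bot_iff.1 (h0 ▸ h.dijkstra_le v))

/-- Admissible paths run through vertices with a finite value. -/
theorem EvalInv.isAdmissiblePath_dijkstra {G : MPG V} {b : ℕ} {B : Finset V}
    {d : V → WithBot ℤ} (h : EvalInv G B d) : ∀ {p : List V} {v : V},
      G.IsAdmissiblePath b {x | d x ≠ ⊥} (B : Set V) (v :: p) →
        G.IsAdmissiblePath b {x | G.dijkstra b B d x ≠ ⊥} (B : Set V) (v :: p)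
  | p, v, hp => by
    have hv : G.dijkstra b B d v ≠ ⊥ := fun h0 => by
      have := h.pathWeight_le_dijkstra hp
      rw [h0] at this
      simp at this
    cases p with
    | nil => exact isAdmissiblePath_singleton.2 ⟨hv, (isAdmissiblePath_singleton.1 hp).2⟩
    | cons u p =>
      obtain ⟨h1, -, h3, h4, h5⟩ := isAdmissiblePath_cons_cons.1 hp
      exact isAdmissiblePath_cons_cons.2 ⟨h1, hv, h3, h4, h.isAdmissiblePath_dijkstra h5⟩

theorem EvalInv.dijkstra {G : MPG V} {b : ℕ} {B : Finset V} {d : V → WithBot ℤ}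
    (h : EvalInv G B d) : EvalInv G B (G.dijkstra b B d) where
  nonpos v := (h.dijkstra_le v).trans (h.nonpos v)
  zero v hv := by
    have h0 : d v ≠ ⊥ := by rw [h.zero v hv]; simp
    refine le_antisymm ((h.dijkstra_le v).trans (h.nonpos v)) ?_
    simpa [pathWeight] using
      h.pathWeight_le_dijkstra (b := b) (isAdmissiblePath_singleton.2 ⟨h0, hv⟩)
  potential v hv hvB u he := by
    by_cases hu : G.dijkstra b B d u = ⊥
    · rw [hu]; simp
    obtain ⟨p, hp, hpw⟩ := exists_of_dijkstra_ne_bot hu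
    obtain ⟨q, hq, hqw⟩ := exists_of_dijkstra_ne_bot hv
    rw [hpw, ← WithBot.coe_add, ← pathWeight_cons_cons]
    -- If prepending `v` breaks the suffix bound, the extended path weighs less than `-b`, hence
    -- less than the longest admissible path from `v`.
    by_cases hb : -(b : ℤ) ≤ G.pathWeight (v :: u :: p)
    · exact h.pathWeight_le_dijkstra
        (isAdmissiblePath_cons_cons.2 ⟨he, h.ne_bot_of_dijkstra hv, hvB, hb, hp⟩)
    · rw [hqw, WithBot.coe_le_coe]
      have := hq.2 _ (List.suffix_refl _)
      omega
  negCycles := h.negCycles.of_potential (d := d) rfl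
    (fun v hv => h.ne_bot_of_dijkstra hv.1)
    fun v hv u he => Or.inr
      ⟨h.potential v (h.ne_bot_of_dijkstra hv.1) hv.2 u he,
        ⟨h.ne_bot_of_dijkstra hv.1, hv.2⟩, he⟩

-- A deleted vertex has only strict edges, so it satisfies the potential inequality and no
-- non-negative closed walk passes through it.
open Classical in
theorem EvalInv.filter {G : MPG V} {B : Finset V} {d : V → WithBot ℤ} (h : EvalInv G B d) :
    EvalInv G (B.filter fun v => G.HasNonnegEdge d v) d where
  nonpos := h.nonpos
  zero v hv := h.zero v (Finset.mem_filter.1 hv).1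
  potential v hv hvB u he := by
    by_cases hB : v ∈ B
    · by_contra hlt
      exact hvB (Finset.mem_filter.2 ⟨hB, u, he, (not_le.1 hlt).le⟩)
    · exact h.potential v hv hB u he
  negCycles := by
    refine h.negCycles.of_potential (d := d) rfl (fun v hv => hv.1) fun v hv u he => ?_
    by_cases hB : v ∈ B
    · left
      by_contra hlt
      exact hv.2 (Finset.mem_filter.2 ⟨hB, u, he, not_lt.1 hlt⟩)
    · exact Or.inr ⟨h.potential v hv.1 hB u he, ⟨hv.1, hB⟩, he⟩

-- The final vector is one `dijkstra` pass applied to some `d₀` that still satisfies `P` with the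
-- final candidate set, so facts about a single pass transfer to the result of the loop.
open Classical in
theorem evalLoop_induction {G : MPG V} {b : ℕ} {P : Finset V → (V → WithBot ℤ) → Prop}
    (hstep : ∀ B d, P B d →
      P (B.filter fun v => G.HasNonnegEdge (G.dijkstra b B d) v) (G.dijkstra b B d)) :
    ∀ (B : Finset V) (d : V → WithBot ℤ), P B d → ∃ d₀, P (G.evalLoop b B d).1 d₀ ∧
      (G.evalLoop b B d).2 = G.dijkstra b (G.evalLoop b B d).1 d₀ ∧
      ∀ v ∈ (G.evalLoop b B d).1, G.HasNonnegEdge (G.evalLoop b B d).2 v := by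
  intro B
  induction B using Finset.strongInduction with
  | H B ih =>
    intro d hP
    rw [evalLoop]
    split_ifs with hB
    · exact ⟨d, hP, rfl, fun v hv => Finset.filter_eq_self.1 hB v hv⟩
    · exact ih _ (Finset.ssubset_iff_subset_ne.2 ⟨Finset.filter_subset _ _, hB⟩) _ (hstep B d hP)

/-- The path `p` is not lost for Max: its weight is bounded below, and its segments satisfy the
weak upper bound `b` unless `b` is so large that simple paths satisfy it anyway. -/
def Withstands [Fintype V] (G : MPG V) (b : ℕ) (p : ℕ → V) : Prop :=
  (∃ M : ℕ, ∀ n, -(M : ℤ) ≤ G.segmentWeight p 0 n) ∧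
    (G.SegmentsBounded b p ∨
      ∃ W : ℕ, (∀ v u, G.Edge v u → -(W : ℤ) ≤ G.weight v u) ∧ b = (Fintype.card V - 1) * W)

theorem Withstands.shift [Fintype V] {G : MPG V} {b : ℕ} {p : ℕ → V} (h : G.Withstands b p)
    (k : ℕ) : G.Withstands b fun i => p (k + i) := by
  obtain ⟨⟨M, hM⟩, h⟩ := h
  refine ⟨⟨M + (G.segmentWeight p 0 k).toNat, fun n => ?_⟩, h.imp_left fun h m n hmn => ?_⟩
  · have h1 := hM (k + n)
    rw [← segmentWeight_add G p (Nat.zero_le k) (by omega)] at h1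
    rw [segmentWeight_shift, add_zero]
    have := Int.self_le_toNat (G.segmentWeight p 0 k)
    push_cast
    omega
  · rw [segmentWeight_shift]
    exact h _ _ (by omega)

/-- The path must meet `B`, since otherwise its weight is unbounded below. Up to the first visit it
is admissible, or can be replaced by a simple path that is admissible and no lighter. -/
theorem EvalInv.exists_segmentWeight_le_dijkstra [Fintype V] {G : MPG V} {b : ℕ} {B : Finset V}
    {d : V → WithBot ℤ} (h : EvalInv G B d) {p : ℕ → V} (he : ∀ i, G.Edge (p i) (p (i + 1)))
    (hD : ∀ i, d (p i) ≠ ⊥) (hp : G.Withstands b p) :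
    ∃ n, (G.segmentWeight p 0 n : WithBot ℤ) ≤ G.dijkstra b B d (p 0) := by
  classical
  have hit : ∃ n, p n ∈ B := by
    by_contra! hB
    obtain ⟨M, hM⟩ := hp.1
    obtain ⟨n, hn⟩ := h.negCycles.exists_segmentWeight_lt (fun i => ⟨hD i, hB i⟩) he M
    exact absurd (hM n) (not_le.2 hn)
  obtain ⟨l, h1, h2, h3⟩ := exists_isPathTo_of_seq (D := {x | d x ≠ ⊥}) (B := (B : Set V))
    (Nat.find hit) p he hD (Nat.find_spec hit) (fun i hi => Nat.find_min hit hi)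
  refine ⟨Nat.find hit, ?_⟩
  rw [← h2]
  rcases hp.2 with hb | ⟨W, hW, hb⟩
  · exact h.pathWeight_le_dijkstra (h3 b hb)
  · obtain ⟨q, hq, hnd, hle⟩ := h1.exists_nodup h.negCycles
    exact (WithBot.coe_le_coe.2 hle).trans
      (h.pathWeight_le_dijkstra (hq.isAdmissiblePath_of_nodup hW hb hnd))

theorem EvalInv.dijkstra_ne_bot_of_withstands [Fintype V] {G : MPG V} {b : ℕ} {B : Finset V}
    {d : V → WithBot ℤ} (h : EvalInv G B d) {p : ℕ → V} (he : ∀ i, G.Edge (p i) (p (i + 1)))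
    (hD : ∀ i, d (p i) ≠ ⊥) (hp : G.Withstands b p) (i : ℕ) :
    G.dijkstra b B d (p i) ≠ ⊥ := by
  obtain ⟨n, hn⟩ := h.exists_segmentWeight_le_dijkstra (p := fun j => p (i + j))
    (fun j => he (i + j)) (fun j => hD (i + j)) (hp.shift i)
  intro h0
  simp only [add_zero] at hn
  rw [h0] at hn
  simp at hn

/-- The result of the evaluation loop, entered with data that satisfy the invariants. -/
theorem EvalInv.evalLoop {G : MPG V} {B : Finset V} {d : V → WithBot ℤ} (h : EvalInv G B d)
    (b : ℕ) : IsEvaluated G b (G.evalLoop b B d).1 (G.evalLoop b B d).2 ∧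
      ∀ v, (G.evalLoop b B d).2 v ≤ d v := by
  classical
  obtain ⟨d₀, ⟨h1, h2⟩, h3, h4⟩ := evalLoop_induction (G := G) (b := b)
    (P := fun B' d' => EvalInv G B' d' ∧ ∀ v, d' v ≤ d v)
    (fun B' d' h' => ⟨h'.1.dijkstra.filter, fun v => (h'.1.dijkstra_le v).trans (h'.2 v)⟩)
    B d ⟨h, fun _ => le_rfl⟩
  refine ⟨⟨h3 ▸ h1.dijkstra, h4, fun v hv => ?_⟩, fun v => ?_⟩
  · rw [h3] at hv ⊢
    obtain ⟨p, hp, hpw⟩ := exists_of_dijkstra_ne_bot hv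
    exact ⟨p, h1.isAdmissiblePath_dijkstra hp, hpw⟩
  · rw [h3]
    exact (h1.dijkstra_le v).trans (h2 v)

/-- Against the evaluated strategy, Max cannot do better than the computed value. -/
theorem EvalInv.exists_segmentWeight_le [Fintype V] {G : MPG V} {b : ℕ} {B : Finset V}
    {d : V → WithBot ℤ} (h : EvalInv G B d) {p : ℕ → V} (he : ∀ i, G.Edge (p i) (p (i + 1)))
    (hD : ∀ i, d (p i) ≠ ⊥) (hp : G.Withstands b p) :
    ∃ n, (G.segmentWeight p 0 n : WithBot ℤ) ≤ (G.evalLoop b B d).2 (p 0) := by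
  classical
  obtain ⟨d₀, ⟨h1, h2⟩, h3, -⟩ := evalLoop_induction (G := G) (b := b)
    (P := fun B' d' => EvalInv G B' d' ∧ ∀ i, d' (p i) ≠ ⊥)
    (fun B' d' h' => ⟨h'.1.dijkstra.filter, h'.1.dijkstra_ne_bot_of_withstands he h'.2 hp⟩)
    B d ⟨h, hD⟩
  rw [h3]
  exact h1.exists_segmentWeight_le_dijkstra he h2 hp

theorem IsEvaluated.neg_le {G : MPG V} {b : ℕ} {B : Finset V} {d : V → WithBot ℤ}
    (h : IsEvaluated G b B d) {v : V} (hv : d v ≠ ⊥) : ((-(b : ℤ) : ℤ) : WithBot ℤ) ≤ d v := by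
  obtain ⟨p, hp, hpw⟩ := h.attained v hv
  rw [hpw]
  exact WithBot.coe_le_coe.2 (hp.2 _ (List.suffix_refl _))

/-! ### Strategy improvement -/

open Classical in
/-- The invariants hold at the beginning of the first strategy evaluation. -/
theorem evalInv_zero [Fintype V] (G : MPG V) : EvalInv G
    (Finset.univ.filter fun v => (fun _ => 0 : V → WithBot ℤ) v = 0 ∧
      G.HasNonnegEdge (fun _ => 0) v) (fun _ => 0) := by
  have hlt : ∀ v, v ∉ (Finset.univ.filter fun v => (fun _ => 0 : V → WithBot ℤ) v = 0 ∧
      G.HasNonnegEdge (fun _ => 0) v) → ∀ u, G.Edge v u →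
      (G.weight v u : WithBot ℤ) + (fun _ => 0 : V → WithBot ℤ) u <
        (fun _ => 0 : V → WithBot ℤ) v := by
    intro v hv u he
    by_contra hlt
    exact hv (Finset.mem_filter.2 ⟨Finset.mem_univ v, rfl, u, he, not_lt.1 hlt⟩)
  refine ⟨fun _ => le_rfl, fun _ _ => rfl, fun v _ hv u he => (hlt v hv u he).le, ?_⟩
  -- Outside the initial candidate set all edges are strict, so the weak alternative never occurs
  -- and `S'` can be empty.
  refine NegCycles.of_potential (H := G) (S' := ∅) (d := fun _ => 0) ?_ rfl
    (fun v hv => hv.1) (fun v hv u he => Or.inl (hlt v hv.2 u he))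
  intro v n z h
  cases h with
  | cons hv => exact absurd hv (Set.notMem_empty v)

open Classical in
/-- A strategy improvement step restores the invariants. -/
theorem IsEvaluated.evalInv_improvement [Fintype V] {G : MPG V} {b : ℕ} {π π' : G.MinPositional}
    {B : Finset V} {d : V → WithBot ℤ} (h : IsEvaluated (G.restrict π) b B d)
    (hπ : G.IsImprovement d π π') :
    EvalInv (G.restrict π') (Finset.univ.filter fun v => d v = 0 ∧
      (G.restrict π').HasNonnegEdge d v) d := by
  -- Strict edges arise at vertices of the old `B` that are not new candidates and at improved
  -- vertices; all other edges were present before.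
  have key : ∀ v, d v ≠ ⊥ → v ∉ (Finset.univ.filter fun v => d v = 0 ∧
      (G.restrict π').HasNonnegEdge d v) → ∀ u, (G.restrict π').Edge v u →
      ((G.restrict π').weight v u : WithBot ℤ) + d u < d v ∨
      (((G.restrict π').weight v u : WithBot ℤ) + d u ≤ d v ∧ v ∈ {x | d x ≠ ⊥ ∧ x ∉ B} ∧
        (G.restrict π).Edge v u) := by
    intro v hv hvB u he
    by_cases hB : v ∈ B
    · left
      by_contra hlt
      exact hvB (Finset.mem_filter.2 ⟨Finset.mem_univ v, h.zero v hB, u, he, not_lt.1 hlt⟩)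
    · have hold : (G.restrict π).Edge v u →
          (((G.restrict π').weight v u : WithBot ℤ) + d u ≤ d v ∧ v ∈ {x | d x ≠ ⊥ ∧ x ∉ B} ∧
            (G.restrict π).Edge v u) := fun he' => ⟨h.potential v hv hB u he', ⟨hv, hB⟩, he'⟩
      rcases he.2 with hmax | hnext
      · exact Or.inr (hold ⟨he.1, Or.inl hmax⟩)
      · by_cases himp : ∃ u, G.ImprovingEdge d v u
        · have := ((hπ v).1 himp).2.2.2
          rw [hnext, add_comm] at this
          exact Or.inl this
        · have := (hπ v).2 himp
          exact Or.inr (hold ⟨he.1, Or.inr (this ▸ hnext)⟩)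
  refine ⟨h.nonpos, fun v hv => (Finset.mem_filter.1 hv).2.1, fun v hv hvB u he => ?_, ?_⟩
  · rcases key v hv hvB u he with h | h
    exacts [h.le, h.1]
  · exact h.negCycles.of_potential (d := d) rfl (fun v hv => hv.1)
      fun v hv u he => key v hv.1 hv.2 u he

/-! ### Runs of the algorithm -/

open Classical in
theorem IsRun.evalInv [Fintype V] {G : MPG V} {b : ℕ} {π : ℕ → G.MinPositional}
    {d : ℕ → V → WithBot ℤ} {N : ℕ} (h : G.IsRun b π d N) : ∀ i ≤ N,
      EvalInv (G.restrict (π i)) (Finset.univ.filter fun v => previous d i v = 0 ∧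
        (G.restrict (π i)).HasNonnegEdge (previous d i) v) (previous d i)
  | 0, _ => evalInv_zero _
  | i + 1, hi => by
    have h1 := ((h.evalInv i (by omega)).evalLoop b).1
    have h2 : d i = ((G.restrict (π i)).evalLoop b _ _).2 := h.eval i (by omega)
    rw [← h2] at h1
    exact h1.evalInv_improvement (h.improve i (by omega))

theorem IsRun.isEvaluated [Fintype V] {G : MPG V} {b : ℕ} {π : ℕ → G.MinPositional}
    {d : ℕ → V → WithBot ℤ} {N : ℕ} (h : G.IsRun b π d N) {i : ℕ} (hi : i ≤ N) :
    IsEvaluated (G.restrict (π i)) b (G.evaluateStrategy b (π i) (previous d i)).1 (d i) := by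
  have h1 := ((h.evalInv i hi).evalLoop b).1
  have h2 : d i = ((G.restrict (π i)).evalLoop b _ _).2 := h.eval i hi
  rw [← h2] at h1
  exact h1

theorem IsRun.le_previous [Fintype V] {G : MPG V} {b : ℕ} {π : ℕ → G.MinPositional}
    {d : ℕ → V → WithBot ℤ} {N : ℕ} (h : G.IsRun b π d N) {i : ℕ} (hi : i ≤ N) (v : V) :
    d i v ≤ previous d i v := by
  have h1 := ((h.evalInv i hi).evalLoop b).2 v
  have h2 : d i = ((G.restrict (π i)).evalLoop b _ _).2 := h.eval i hi
  rw [← h2] at h1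
  exact h1

/-- After an improvement, the vector of the old strategy is not the vector of the new one. -/
theorem IsEvaluated.not_improvable {G : MPG V} {b : ℕ} {π π' : G.MinPositional}
    {B : Finset V} {d : V → WithBot ℤ} (h : IsEvaluated (G.restrict π') b B d)
    (hπ : G.IsImprovement d π π') : ¬ G.Improvable d := by
  rintro ⟨v, u, hu⟩
  obtain ⟨hv, hd, -, hlt⟩ := (hπ v).1 ⟨u, hu⟩
  rw [add_comm] at hlt
  have hnext : ∀ {u}, (G.restrict π').Edge v u → π'.next v = u := fun he =>
    he.2.resolve_left hv
  -- The only edge of `π'` at `v` is non-negative after the transformation: in `B` by the stopping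
  -- condition, elsewhere as the first edge of a longest path.
  by_cases hB : v ∈ B
  · obtain ⟨u', he, hle⟩ := h.edge v hB
    rw [← hnext he] at hle
    exact absurd hlt (not_lt.2 hle)
  · obtain ⟨p, hp, hpw⟩ := h.attained v hd.ne'
    cases p with
    | nil => exact hB (isAdmissiblePath_singleton.1 hp).2
    | cons u' p =>
      obtain ⟨he, -, -, -, hp'⟩ := isAdmissiblePath_cons_cons.1 hp
      have hle := h.pathWeight_le hp'.1
      rw [pathWeight_cons_cons, WithBot.coe_add] at hpw
      rw [hnext he] at hlt
      exact absurd hlt (not_lt.2 (hpw.le.trans (add_le_add le_rfl hle)))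

/-- Evaluation never increases the vector, and it cannot leave an improvable vector unchanged after
the improvement. All values lie in {-∞, -b, …, 0}. -/
theorem not_exists_infinite_run [Fintype V] (G : MPG V) (b : ℕ) :
    ¬ ∃ (π : ℕ → G.MinPositional) (d : ℕ → V → WithBot ℤ), ∀ N, G.IsRun b π d N := by
  rintro ⟨π, d, h⟩
  have hanti : StrictAnti d := by
    refine strictAnti_nat_of_succ_lt fun i => lt_of_le_of_ne
      (fun v => (h (i + 1)).le_previous le_rfl v) fun heq => ?_
    have h1 := (h (i + 1)).isEvaluated le_rfl
    rw [heq] at h1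
    exact h1.not_improvable ((h (i + 1)).improve i (Nat.lt_succ_self i))
      ((h (i + 1)).improvable i (Nat.lt_succ_self i))
  have hfin : {f : V → WithBot ℤ | ∀ v, f v ∈
      insert ⊥ ((fun z : ℤ => (z : WithBot ℤ)) '' Set.Icc (-(b : ℤ)) 0)}.Finite :=
    Set.Finite.pi' fun _ => ((Set.finite_Icc _ _).image _).insert _
  suffices hmem : ∀ i, d i ∈ {f : V → WithBot ℤ | ∀ v, f v ∈
      insert ⊥ ((fun z : ℤ => (z : WithBot ℤ)) '' Set.Icc (-(b : ℤ)) 0)} from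
    Set.infinite_of_injective_forall_mem hanti.injective hmem hfin
  intro i v
  have h1 := (h i).isEvaluated le_rfl
  by_cases hv : d i v = ⊥
  · exact Or.inl hv
  · right
    have h2 := h1.neg_le hv
    have h3 := h1.nonpos v
    obtain ⟨z, hz⟩ := WithBot.ne_bot_iff_exists.1 hv
    rw [← hz] at h2 h3
    exact ⟨z, ⟨WithBot.coe_le_coe.1 h2, by exact_mod_cast h3⟩, hz⟩

theorem exists_isImprovement (G : MPG V) (d : V → WithBot ℤ) (π : G.MinPositional) :
    ∃ π', G.IsImprovement d π π' := by
  classical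
  refine ⟨⟨fun v => if h : ∃ u, G.ImprovingEdge d v u then h.choose else π.next v,
    fun v hv => ?_⟩, fun v => ⟨fun h => ?_, fun h => ?_⟩⟩
  · split_ifs with h
    exacts [h.choose_spec.2.2.1, π.legal v hv]
  · simpa only [dif_pos h] using h.choose_spec
  · simp only [dif_neg h]

theorem exists_isCompleteRun [Fintype V] (G : MPG V) (b : ℕ) (π₀ : G.MinPositional) :
    ∃ (π : ℕ → G.MinPositional) (d : ℕ → V → WithBot ℤ) (N : ℕ),
      π 0 = π₀ ∧ G.IsCompleteRun b π d N := by
  classical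
  choose next hnext using G.exists_isImprovement
  let s : ℕ → G.MinPositional × (V → WithBot ℤ) := fun n =>
    Nat.rec (π₀, (G.evaluateStrategy b π₀ fun _ => 0).2)
      (fun _ s => (next s.2 s.1, (G.evaluateStrategy b (next s.2 s.1) s.2).2)) n
  have heval : ∀ i, (s i).2 =
      (G.evaluateStrategy b (s i).1 (previous (fun i => (s i).2) i)).2 := by
    intro i
    cases i <;> rfl
  have hterm : ∃ N, ¬ G.Improvable (s N).2 := by
    by_contra! h
    exact G.not_exists_infinite_run b ⟨fun i => (s i).1, fun i => (s i).2, fun N =>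
      ⟨fun i _ => heval i, fun i _ => h i, fun i _ => hnext _ _⟩⟩
  exact ⟨fun i => (s i).1, fun i => (s i).2, Nat.find hterm, rfl,
    ⟨fun i _ => heval i, fun i hi => not_not.1 (Nat.find_min hterm hi), fun i _ => hnext _ _⟩,
    Nat.find_spec hterm⟩

/-! ### Plays -/

theorem outcome_succ_of_mem (G : MPG V) (v : V) (σ : G.MaxStrategy) (π : G.MinStrategy) (n : ℕ)
    (h : G.outcome v σ π n ∈ G.VMax) : G.outcome v σ π (n + 1) =
      σ.move (G.playState v σ π n).1 (G.outcome v σ π n) :=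
  if_pos h

theorem outcome_succ_of_notMem (G : MPG V) (v : V) (σ : G.MaxStrategy) (π : G.MinStrategy)
    (n : ℕ) (h : G.outcome v σ π n ∉ G.VMax) : G.outcome v σ π (n + 1) =
      π.move (G.playState v σ π n).1 (G.outcome v σ π n) :=
  if_neg h

theorem playState_succ_fst (G : MPG V) (v : V) (σ : G.MaxStrategy) (π : G.MinStrategy) (n : ℕ) :
    (G.playState v σ π (n + 1)).1 = (G.playState v σ π n).1 ++ [G.outcome v σ π n] := rfl

/-- Strategies are legal only after finite paths, so the chain property of the history has to be
carried through an induction on the length of the play. -/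
theorem edge_outcome_of_isChain (G : MPG V) (v : V) (σ : G.MaxStrategy) (π : G.MinStrategy)
    (n : ℕ) (h : List.IsChain G.Edge ((G.playState v σ π n).1 ++ [G.outcome v σ π n])) :
    G.Edge (G.outcome v σ π n) (G.outcome v σ π (n + 1)) := by
  by_cases hv : G.outcome v σ π n ∈ G.VMax
  · rw [outcome_succ_of_mem _ _ _ _ _ hv]
    exact σ.legal _ _ hv h
  · rw [outcome_succ_of_notMem _ _ _ _ _ hv]
    exact π.legal _ _ hv h

theorem isChain_playState (G : MPG V) (v : V) (σ : G.MaxStrategy) (π : G.MinStrategy) (n : ℕ) :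
    List.IsChain G.Edge ((G.playState v σ π n).1 ++ [G.outcome v σ π n]) := by
  induction n with
  | zero => exact List.isChain_singleton v
  | succ n ih =>
    rw [playState_succ_fst, List.isChain_append]
    refine ⟨ih, List.isChain_singleton _, fun x hx y hy => ?_⟩
    simp at hx hy
    subst hx hy
    exact edge_outcome_of_isChain G v σ π n ih

theorem edge_outcome (G : MPG V) (v : V) (σ : G.MaxStrategy) (π : G.MinStrategy) (n : ℕ) :
    G.Edge (G.outcome v σ π n) (G.outcome v σ π (n + 1)) :=
  edge_outcome_of_isChain G v σ π n (isChain_playState G v σ π n)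

theorem mem_playState_iff (G : MPG V) (v : V) (σ : G.MaxStrategy) (π : G.MinStrategy) (n : ℕ)
    (x : V) : x ∈ (G.playState v σ π n).1 ++ [G.outcome v σ π n] ↔
      ∃ j ≤ n, x = G.outcome v σ π j := by
  induction n with
  | zero => simp [playState, outcome]
  | succ n ih =>
    rw [playState_succ_fst, List.mem_append, ih, List.mem_singleton]
    constructor
    · rintro (⟨j, hj, hx⟩ | hx)
      exacts [⟨j, by omega, hx⟩, ⟨n + 1, le_rfl, hx⟩]
    · rintro ⟨j, hj, hx⟩
      rcases Nat.lt_or_ge n j with h | h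
      · right; rw [hx, show j = n + 1 by omega]
      · exact Or.inl ⟨j, h, hx⟩

/-- A path along which the potential `d` is respected. -/
theorem le_segmentWeight_add {G : MPG V} {d : V → WithBot ℤ} {p : ℕ → V}
    (h : ∀ i, d (p i) ≠ ⊥ → d (p i) ≤ (G.weight (p i) (p (i + 1)) : WithBot ℤ) + d (p (i + 1)))
    {m : ℕ} (hm : d (p m) ≠ ⊥) (n : ℕ) :
    d (p (m + n)) ≠ ⊥ ∧ d (p m) ≤ (G.segmentWeight p m (m + n) : WithBot ℤ) + d (p (m + n)) := by
  induction n with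
  | zero => exact ⟨hm, by simp [segmentWeight]⟩
  | succ n ih =>
    obtain ⟨h1, h2⟩ := ih
    have h3 := h _ h1
    refine ⟨fun h0 => h1 ?_, ?_⟩
    · rw [add_assoc, h0] at h3
      simpa using h3
    · have h4 := segmentWeight_add G p (Nat.le_add_right m n) (Nat.le_succ (m + n))
      have h5 : G.segmentWeight p (m + n) (m + n).succ = G.weight (p (m + n)) (p (m + n + 1)) := by
        simp [segmentWeight]
      rw [← add_assoc, ← Nat.succ_eq_add_one (m + n), ← h4, h5, WithBot.coe_add, add_assoc]
      exact h2.trans (add_le_add le_rfl h3)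

/-- A segment from m to n weighs at least d(p m) - d(p n) ≥ d(p m), because d is non-positive. -/
theorem survives_of_potential {G : MPG V} {b x : ℕ} {d : V → WithBot ℤ} {p : ℕ → V}
    (h : ∀ i, d (p i) ≠ ⊥ → d (p i) ≤ (G.weight (p i) (p (i + 1)) : WithBot ℤ) + d (p (i + 1)))
    (hnonpos : ∀ v, d v ≤ 0) (hb : ∀ v, d v ≠ ⊥ → ((-(b : ℤ) : ℤ) : WithBot ℤ) ≤ d v)
    (hx : ((-(x : ℤ) : ℤ) : WithBot ℤ) ≤ d (p 0)) : G.Survives b x p := by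
  have key : ∀ (m n : ℕ), m ≤ n → ∀ z : ℤ, (z : WithBot ℤ) ≤ d (p m) →
      z ≤ G.segmentWeight p m n := by
    intro m n hmn z hz
    have hm : d (p m) ≠ ⊥ := fun h0 => by simp [h0] at hz
    obtain ⟨k, rfl⟩ := Nat.exists_eq_add_of_le hmn
    have h1 := (hz.trans (le_segmentWeight_add h hm k).2).trans
      (add_le_add le_rfl (hnonpos _))
    rw [add_zero] at h1
    exact WithBot.coe_le_coe.1 h1
  have h0 : d (p 0) ≠ ⊥ := fun h0 => by simp [h0] at hx
  refine ⟨fun n => ?_, fun m n hmn => ?_⟩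
  · have := key 0 n (Nat.zero_le n) _ hx
    omega
  · have := (le_segmentWeight_add h h0 m).1
    rw [zero_add] at this
    exact key m n hmn.le _ (hb _ this)

/-! ### Optimal strategies -/

theorem le_weight_add_of_not_improvable {G : MPG V} {d : V → WithBot ℤ} (h : ¬ G.Improvable d)
    {v u : V} (hv : v ∉ G.VMax) (hd : d v ≠ ⊥) (he : G.Edge v u) :
    d v ≤ (G.weight v u : WithBot ℤ) + d u := by
  by_contra hlt
  rw [not_le, add_comm] at hlt
  exact h ⟨v, u, hv, bot_lt_iff_ne_bot.2 hd, he, hlt⟩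

theorem IsEvaluated.exists_readOffForest {G : MPG V} {b : ℕ} {π : G.MinPositional}
    {B : Finset V} {d : V → WithBot ℤ} (h : IsEvaluated (G.restrict π) b B d) :
    ∃ σ : G.MaxPositional, G.ReadOffForest b π B d σ := by
  have key : ∀ v, ∃ u, G.Edge v u ∧ (d v ≠ ⊥ →
      (v ∈ B → d v ≤ (G.weight v u : WithBot ℤ) + d u) ∧
      (v ∉ B → ∃ p : List V,
        (G.restrict π).IsAdmissiblePath b {x | d x ≠ ⊥} (B : Set V) (v :: u :: p) ∧
        d v = ((G.restrict π).pathWeight (v :: u :: p) : WithBot ℤ))) := by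
    intro v
    by_cases hv : d v = ⊥
    · obtain ⟨u, hu⟩ := G.exists_edge v
      exact ⟨u, hu, fun h => absurd hv h⟩
    by_cases hB : v ∈ B
    · obtain ⟨u, hu, hle⟩ := h.edge v hB
      exact ⟨u, hu.1, fun _ => ⟨fun _ => hle, fun h => absurd hB h⟩⟩
    · obtain ⟨p, hp, hpw⟩ := h.attained v hv
      cases p with
      | nil => exact absurd (isAdmissiblePath_singleton.1 hp).2 hB
      | cons u p =>
        exact ⟨u, (isAdmissiblePath_cons_cons.1 hp).1.1, fun _ =>
          ⟨fun h => absurd h hB, fun _ => ⟨p, hp, hpw⟩⟩⟩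
  choose next h1 h2 using key
  exact ⟨⟨next, fun v _ => h1 v⟩, fun v _ hv => h2 v hv⟩

/-- Outside `B`, the rest of the longest path weighs at most the value of its first vertex. -/
theorem ReadOffForest.le_weight_add {G : MPG V} {b : ℕ} {π : G.MinPositional}
    {B : Finset V} {d : V → WithBot ℤ} {σ : G.MaxPositional} (hσ : G.ReadOffForest b π B d σ)
    (h : IsEvaluated (G.restrict π) b B d) {v : V} (hv : v ∈ G.VMax) (hd : d v ≠ ⊥) :
    d v ≤ (G.weight v (σ.next v) : WithBot ℤ) + d (σ.next v) := by
  by_cases hB : v ∈ B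
  · exact (hσ v hv hd).1 hB
  · obtain ⟨p, hp, hpw⟩ := (hσ v hv hd).2 hB
    have hle := h.pathWeight_le (isAdmissiblePath_cons_cons.1 hp).2.2.2.2.1
    rw [hpw, pathWeight_cons_cons, WithBot.coe_add]
    exact add_le_add le_rfl hle

theorem ReadOffForest.survives {G : MPG V} {b : ℕ} {π : G.MinPositional}
    {B : Finset V} {d : V → WithBot ℤ} {σ : G.MaxPositional} (hσ : G.ReadOffForest b π B d σ)
    (h : IsEvaluated (G.restrict π) b B d) (himp : ¬ G.Improvable d) {v : V} {x : ℕ}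
    (hx : ((-(x : ℤ) : ℤ) : WithBot ℤ) ≤ d v) (τ : G.MinStrategy) :
    G.Survives b x (G.outcome v σ.toStrategy τ) := by
  refine survives_of_potential (d := d) (fun i hi => ?_) h.nonpos (fun _ hv => h.neg_le hv) hx
  by_cases hv : G.outcome v σ.toStrategy τ i ∈ G.VMax
  · rw [outcome_succ_of_mem _ _ _ _ _ hv]
    exact hσ.le_weight_add h hv hi
  · exact le_weight_add_of_not_improvable himp hv hi (edge_outcome _ _ _ _ _)

/-- Against the switching strategy, Max cannot do better than the computed value. -/
theorem IsRun.exists_segmentWeight_le [Fintype V] {G : MPG V} {b : ℕ} {π : ℕ → G.MinPositional}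
    {d : ℕ → V → WithBot ℤ} {N : ℕ} (h : G.IsRun b π d N) (v : V) (σ : G.MaxStrategy)
    (hw : G.Withstands b (G.outcome v σ (G.switchingStrategy π d N))) :
    ∃ n, (G.segmentWeight (G.outcome v σ (G.switchingStrategy π d N)) 0 n : WithBot ℤ) ≤
      d N v := by
  classical
  set τ := G.switchingStrategy π d N with hτ
  set p := G.outcome v σ τ with hp
  -- `k` is the index on which the switching strategy finally settles, as it refers to all vertices
  -- of the infinite play.
  set S : Set ℕ := {i | i = N ∨ ∃ j, d i (p j) = ⊥} with hS
  set k := sInf S with hk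
  have hkS : k ∈ S := Nat.sInf_mem ⟨N, Or.inl rfl⟩
  have hkN : k ≤ N := Nat.sInf_le (Or.inl rfl)
  -- By minimality of `k`, the vector with which evaluation `k` is entered is finite along the whole
  -- play; for k = 0 it is the zero vector.
  have hprev : ∀ j, previous d k (p j) ≠ ⊥ := by
    intro j
    rcases hk' : k with _ | i
    · simp [previous]
    · intro h0
      have : k ≤ i := Nat.sInf_le (Or.inr ⟨j, h0⟩)
      omega
  -- Once a witness for `k` has been visited, Min uses `π k` forever: a smaller index would have a
  -- witness in the play too.
  have hindex : ∀ n, (k = N ∨ ∃ j ≤ n, d k (p j) = ⊥) →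
      switchIndex d N ((G.playState v σ τ n).1 ++ [p n]) = k := by
    intro n hn
    refine le_antisymm (Nat.sInf_le ?_) (Nat.sInf_le ?_)
    · refine hn.imp_right ?_
      rintro ⟨j, hj, h0⟩
      exact ⟨p j, (mem_playState_iff G v σ τ n _).2 ⟨j, hj, rfl⟩, h0⟩
    · have hmem := Nat.sInf_mem (s := {i : ℕ | i = N ∨
        ∃ x ∈ (G.playState v σ τ n).1 ++ [p n], d i x = ⊥}) ⟨N, Or.inl rfl⟩
      refine hmem.imp_right ?_
      rintro ⟨x, hx, h0⟩
      obtain ⟨j, -, rfl⟩ := (mem_playState_iff G v σ τ n x).1 hx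
      exact ⟨j, h0⟩
  have hedge : ∀ n, (k = N ∨ ∃ j ≤ n, d k (p j) = ⊥) →
      (G.restrict (π k)).Edge (p n) (p (n + 1)) := by
    intro n hn
    refine ⟨edge_outcome G v σ τ n, ?_⟩
    by_cases hv : p n ∈ G.VMax
    · exact Or.inl hv
    · right
      rw [hp, outcome_succ_of_notMem G v σ τ n hv, ← hindex n hn]
      rfl
  have htail : ∀ t, (k = N ∨ ∃ j ≤ t, d k (p j) = ⊥) →
      ∃ n, (G.segmentWeight p t (t + n) : WithBot ℤ) ≤ d k (p t) := by
    intro t ht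
    have hsh := hw.shift t
    have hsh' : (G.restrict (π k)).Withstands b fun i => p (t + i) :=
      ⟨hsh.1, hsh.2.imp_right fun ⟨W, hW, hb⟩ => ⟨W, fun v u he => hW v u he.1, hb⟩⟩
    obtain ⟨n, hn⟩ := (h.evalInv k hkN).exists_segmentWeight_le (p := fun i => p (t + i))
      (fun i => hedge (t + i) (ht.imp_right fun ⟨j, hj, h0⟩ => ⟨j, by omega, h0⟩))
      (fun i => hprev (t + i)) hsh'
    have heval : d k = ((G.restrict (π k)).evalLoop b _ _).2 := h.eval k hkN
    rw [← heval] at hn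
    refine ⟨n, ?_⟩
    have := segmentWeight_shift G p t 0 n
    rw [add_zero] at this
    rw [← this]
    exact hn
  -- The tail starting at a vertex of value `-∞` follows `π k`, so an integer weight would be
  -- bounded by `-∞`.
  have hnot : ∀ j, d k (p j) ≠ ⊥ := by
    intro j h0
    obtain ⟨n, hn⟩ := htail j (Or.inr ⟨j, le_rfl, h0⟩)
    rw [h0] at hn
    simp at hn
  have hkN' : k = N := hkS.resolve_right fun ⟨j, h0⟩ => hnot j h0
  obtain ⟨n, hn⟩ := htail 0 (Or.inl hkN')
  rw [hkN', zero_add] at hn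
  exact ⟨n, hn⟩

/-! ### The value -/

/-- The two hypotheses say that `S` consists of the x with -x ≤ δ; since δ ≤ 0, its minimum is -δ.
-/
theorem negate_eq_ofENat_minOrTop {δ : WithBot ℤ} {S : Set ℕ} (hδ : δ ≤ 0)
    (h1 : ∀ x : ℕ, ((-(x : ℤ) : ℤ) : WithBot ℤ) ≤ δ → x ∈ S)
    (h2 : ∀ x ∈ S, ((-(x : ℤ) : ℤ) : WithBot ℤ) ≤ δ) :
    negate δ = ofENat (minOrTop S) := by
  induction δ with
  | bot =>
    have : minOrTop S = ⊤ := by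
      simp only [minOrTop, iInf_eq_top]
      intro x hx
      have := h2 x hx
      simp at this
    rw [this]
    rfl
  | coe z =>
    have hz : z ≤ 0 := by exact_mod_cast hδ
    obtain ⟨y, hy⟩ := Int.eq_ofNat_of_zero_le (a := -z) (by omega)
    have : minOrTop S = (y : ℕ∞) := by
      refine le_antisymm (iInf₂_le y (h1 y (WithBot.coe_le_coe.2 (by omega))))
        (le_iInf₂ fun x hx => ?_)
      have := WithBot.coe_le_coe.1 (h2 x hx)
      exact Nat.cast_le.2 (by omega)
    rw [this]
    show ((-z : ℤ) : WithTop ℤ) = ((y : ℤ) : WithTop ℤ)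
    rw [hy]

theorem eq_neg_of_negate_eq {δ : WithBot ℤ} {y : ℕ} (h : negate δ = ofENat (y : ℕ∞)) :
    δ = ((-(y : ℤ) : ℤ) : WithBot ℤ) := by
  change negate δ = ((y : ℤ) : WithTop ℤ) at h
  induction δ with
  | bot => exact absurd h.symm (WithTop.coe_ne_top)
  | coe z =>
    have : -z = (y : ℤ) := WithTop.coe_injective h
    rw [← this, neg_neg]

theorem eq_bot_of_negate_eq {δ : WithBot ℤ} (h : negate δ = ofENat ⊤) : δ = ⊥ := by
  change negate δ = (⊤ : WithTop ℤ) at h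
  induction δ with
  | bot => rfl
  | coe z => exact absurd h (WithTop.coe_ne_top)

theorem neg_maxAbsWeight_le [Fintype V] (G : MPG V) (v u : V) (he : G.Edge v u) :
    -(G.maxAbsWeight : ℤ) ≤ G.weight v u := by
  classical
  have h : (G.weight v u).natAbs ≤ G.maxAbsWeight := by
    unfold maxAbsWeight
    exact Finset.le_sup (f := fun e : V × V => (G.weight e.1 e.2).natAbs) (b := (v, u))
      (by simpa using he)
  omega

theorem Survives.withstands [Fintype V] {G : MPG V} {b x : ℕ} {p : ℕ → V}
    (h : G.Survives b x p) : G.Withstands b p :=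
  ⟨⟨x, fun n => by have := h.1 n; omega⟩, Or.inl h.2⟩

theorem KeepsNonneg.withstands [Fintype V] {G : MPG V} {x : ℕ} {p : ℕ → V}
    (h : G.KeepsNonneg x p) : G.Withstands ((Fintype.card V - 1) * G.maxAbsWeight) p :=
  ⟨⟨x, fun n => by have := h n; omega⟩, Or.inr ⟨_, G.neg_maxAbsWeight_le, rfl⟩⟩

/-- The energy that Max needs against the switching strategy. -/
theorem IsRun.neg_le_of_keepsNonneg [Fintype V] {G : MPG V} {b : ℕ} {π : ℕ → G.MinPositional}
    {d : ℕ → V → WithBot ℤ} {N : ℕ} (h : G.IsRun b π d N) {v : V} {σ : G.MaxStrategy} {x : ℕ}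
    (hw : G.Withstands b (G.outcome v σ (G.switchingStrategy π d N)))
    (hx : G.KeepsNonneg x (G.outcome v σ (G.switchingStrategy π d N))) :
    ((-(x : ℤ) : ℤ) : WithBot ℤ) ≤ d N v := by
  obtain ⟨n, hn⟩ := h.exists_segmentWeight_le v σ hw
  refine le_trans (WithBot.coe_le_coe.2 ?_) hn
  have := hx n
  omega

theorem IsCompleteRun.negate_eq_lwub [Fintype V] {G : MPG V} {b : ℕ} {π : ℕ → G.MinPositional}
    {d : ℕ → V → WithBot ℤ} {N : ℕ} (h : G.IsCompleteRun b π d N) (v : V) :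
    negate (d N v) = ofENat (G.lwub b v) := by
  have he := h.1.isEvaluated le_rfl
  obtain ⟨σ, hσ⟩ := he.exists_readOffForest
  refine negate_eq_ofENat_minOrTop (he.nonpos v)
    (fun x hx => ⟨σ.toStrategy, hσ.survives he h.2 hx⟩) ?_
  rintro x ⟨σ', hσ'⟩
  have hs := hσ' (G.switchingStrategy π d N)
  exact h.1.neg_le_of_keepsNonneg hs.withstands hs.1

/-- Max's strategy keeps even the weak upper bound, while Min's bound, for this `b`, only needs the
energy to stay bounded below. -/
theorem IsCompleteRun.negate_eq_lb [Fintype V] {G : MPG V} {b : ℕ} {π : ℕ → G.MinPositional}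
    {d : ℕ → V → WithBot ℤ} {N : ℕ} (h : G.IsCompleteRun b π d N)
    (hb : b = (Fintype.card V - 1) * G.maxAbsWeight) (v : V) :
    negate (d N v) = ofENat (G.lb v) := by
  have he := h.1.isEvaluated le_rfl
  obtain ⟨σ, hσ⟩ := he.exists_readOffForest
  refine negate_eq_ofENat_minOrTop (he.nonpos v)
    (fun x hx => ⟨σ.toStrategy, fun τ => (hσ.survives he h.2 hx τ).1⟩) ?_
  rintro x ⟨σ', hσ'⟩
  have hs := hσ' (G.switchingStrategy π d N)
  exact h.1.neg_le_of_keepsNonneg (hb ▸ hs.withstands) hs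

end MPG

theorem theorem2 {V : Type*} [Fintype V] (G : MPG V) (b : ℕ) :
    -- every execution terminates, and every initial strategy of Min has an execution
    (¬ ∃ (π : ℕ → G.MinPositional) (d : ℕ → V → WithBot ℤ), ∀ N, G.IsRun b π d N) ∧
    (∀ π₀ : G.MinPositional, ∃ (π : ℕ → G.MinPositional) (d : ℕ → V → WithBot ℤ) (N : ℕ),
      π 0 = π₀ ∧ G.IsCompleteRun b π d N) ∧
    ∀ (π : ℕ → G.MinPositional) (d : ℕ → V → WithBot ℤ) (N : ℕ), G.IsCompleteRun b π d N →
      -- the returned vector solves the lower-weak-upper-bound problem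
      (∀ v, MPG.negate (d N v) = MPG.ofENat (G.lwub b v)) ∧
      -- it solves the lower-bound problem if `b = (|V| - 1) * W`
      (b = (Fintype.card V - 1) * G.maxAbsWeight →
        ∀ v, MPG.negate (d N v) = MPG.ofENat (G.lb v)) ∧
      -- the positional strategies of Max read off the final longest-path forest are optimal
      (∃ σ : G.MaxPositional, G.ReadOffForest b (π N)
        (G.evaluateStrategy b (π N) (MPG.previous d N)).1 (d N) σ) ∧
      (∀ σ : G.MaxPositional, G.ReadOffForest b (π N)
        (G.evaluateStrategy b (π N) (MPG.previous d N)).1 (d N) σ →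
          G.IsOptimalMax b σ.toStrategy) ∧
      -- the strategy of Min that switches through the computed strategies is optimal
      G.IsOptimalMin b (G.switchingStrategy π d N) := by
  refine ⟨G.not_exists_infinite_run b, G.exists_isCompleteRun b, fun π d N h => ?_⟩
  have he := h.1.isEvaluated le_rfl
  refine ⟨h.negate_eq_lwub, h.negate_eq_lb, he.exists_readOffForest, ?_, ?_⟩
  · intro σ hσ v x hx τ
    have hv := h.negate_eq_lwub v
    rw [hx] at hv
    exact hσ.survives he h.2 (MPG.eq_neg_of_negate_eq hv).ge τ
  · refine fun v => ⟨fun y hy σ x hs => ?_, fun htop σ x hs => ?_⟩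
    · have hle := h.1.neg_le_of_keepsNonneg hs.withstands hs.1
      have hv := h.negate_eq_lwub v
      rw [hy] at hv
      rw [MPG.eq_neg_of_negate_eq hv, WithBot.coe_le_coe] at hle
      omega
    · have hle := h.1.neg_le_of_keepsNonneg hs.withstands hs.1
      have hv := h.negate_eq_lwub v
      rw [htop] at hv
      rw [MPG.eq_bot_of_negate_eq hv] at hle
      simp at hle
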